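/- All rings are commutative and noetherian, and all modules are finitely generated. A module $M$ over a ring $R$ is maximal Cohen--Macaulay if $\operatorname{depth} M_{\mathfrak p}\ge\dim R_{\mathfrak p}$ for all $\mathfrak p\in\operatorname{Spec}R$ (the zero module has infinite depth). A Cohen--Macaulay local ring $R$ is said to have infinite $\mathsf{CM}_+$-representation type if there are infinitely many isomorphism classes of indecomposable maximal Cohen--Macaulay $R$-modules $M$ that are not locally free on the punctured spectrum, i.e. such that $M_{\mathfrak p}$ is not a free $R_{\mathfrak p}$-module for some nonmaximal prime ideal $\mathfrak p$ of $R$. Theorem 33. Let $S$ be a regular local ring of dimension two, and let $p,q,r$ be irreducible elements of $S$ that are pairwise distinct in the sense that the ideals $pS,qS,rS$ are pairwise different. Then $R=S/(p^2qr)$ is a Cohen--Macaulay ring, and it has infinite $\mathsf{CM}_+$-representation type. -/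

import Mathlib

universe u v

namespace CMRep

open CategoryTheory IsLocalRing

/-- The depth of a module `M` over a local ring `A`: the supremum of the lengths of the `M`-regular
sequences in the maximal ideal. For `M` finitely generated and nonzero over a noetherian local ring,
weakly regular and regular sequences in the maximal ideal are the same by Nakayama's lemma; for
`M = 0` the value is `⊤`, the usual convention. -/
noncomputable def depth (A : Type u) [CommRing A] [IsLocalRing A]
    (M : Type v) [AddCommGroup M] [Module A M] : ℕ∞ :=
  ⨆ rs : {rs : List A // (∀ r ∈ rs, r ∈ maximalIdeal A) ∧ RingTheory.Sequence.IsWeaklyRegular M rs},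
    (rs.1.length : ℕ∞)

/-- A finitely generated module `M` is maximal Cohen-Macaulay if
`depth M_P ≥ dim R_P` for all primes `P` of `R`. The zero module is maximal Cohen-Macaulay. -/
def IsMaximalCohenMacaulay (R : Type u) [CommRing R]
    (M : Type v) [AddCommGroup M] [Module R M] : Prop :=
  Module.Finite R M ∧ ∀ P : PrimeSpectrum R,
    ringKrullDim (Localization.AtPrime P.asIdeal) ≤
      (depth (Localization.AtPrime P.asIdeal)
        (LocalizedModule P.asIdeal.primeCompl M) : WithBot ℕ∞)

/-- A noetherian ring is Cohen-Macaulay if `depth R_P = dim R_P` for all primes `P`. -/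
def IsCohenMacaulayRing (R : Type u) [CommRing R] : Prop :=
  IsNoetherianRing R ∧ ∀ P : PrimeSpectrum R,
    (depth (Localization.AtPrime P.asIdeal) (Localization.AtPrime P.asIdeal) : WithBot ℕ∞) =
      ringKrullDim (Localization.AtPrime P.asIdeal)

/-- `M` is locally free on the punctured spectrum: `M_P` is a free `R_P`-module for every
nonmaximal prime `P` of `R`. -/
def IsLocallyFreeOnPuncturedSpectrum (R : Type u) [CommRing R]
    (M : Type v) [AddCommGroup M] [Module R M] : Prop :=
  ∀ P : PrimeSpectrum R, ¬ P.asIdeal.IsMaximal →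
    Module.Free (Localization.AtPrime P.asIdeal) (LocalizedModule P.asIdeal.primeCompl M)

/-- Membership in `CM₊(R)`: maximal Cohen-Macaulay and not locally free on the punctured
spectrum. -/
def IsCMPlus (R : Type u) [CommRing R] (M : Type v) [AddCommGroup M] [Module R M] : Prop :=
  IsMaximalCohenMacaulay R M ∧ ¬ IsLocallyFreeOnPuncturedSpectrum R M

/-- The set of isomorphism classes of indecomposable modules in `CM₊(R)`. Modules are taken in the
universe of `R`, where every finitely generated module has an isomorphic copy. -/
def indCMPlus (R : Type u) [CommRing R] : Set (Quotient (isIsomorphicSetoid (ModuleCat.{u} R))) :=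
  {c | ∃ M : ModuleCat.{u} R, Indecomposable M ∧ IsCMPlus R M ∧
    Quotient.mk (isIsomorphicSetoid (ModuleCat.{u} R)) M = c}

/-- Infinite `CM₊`-representation type. -/
def HasInfiniteCMPlusRepresentationType (R : Type u) [CommRing R] : Prop :=
  (indCMPlus R).Infinite

end CMRep

/-! Put `R = S/(p²qr)`. For `b` in the maximal ideal with `p ∤ b`, let `M_b` be the `R`-module with
generators `e₁, e₂, e₃` and relations `p e₁ = 0`, `b e₁ + pq e₂ = 0`, `b e₁ + pr e₃ = 0`, an
extension of `R/(pq) ⊕ R/(pr)` by `R/(p)`. Choose `x` in the maximal ideal outside `(p)`, `(q)`,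
`(r)`; the modules `M_b` with `b = xⁿ`, `n ≥ 1`, form the infinite family.

Since `dim R ≤ 1`, a nonzerodivisor in the maximal ideal suffices for maximal depth, and `x` is one
on `R` and on `M_b`. At the prime `(p)` the element `b` is a unit, `e₁` can be eliminated, and what
remains is `R_P ⊕ R_P/(p)`, which is not free. With only one of `e₂, e₃` the localization would be
free, hence three generators. The ideal `(p, b)` can be read off from `M_b`
(`TripleExt.exists_eq_of_linearEquiv`), and the ideals `(p, xⁿ)` are distinct. Finally, if `M_b`
split, one summand would be cyclic because there are only three generators, and
`TripleExt.one_sub_notMem` excludes a nonzero cyclic summand.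

The arithmetic needed is that `S` is a domain whose irreducible elements are prime. In dimension two
this is elementary: modulo one of two generators of the maximal ideal, `S` becomes a principal ideal
domain, and Nakayama lifts the information back. -/

/-! ### Two-dimensional regular local rings: domain, irreducibles are prime -/

section RegularLocalRing

open IsLocalRing

/-- A noetherian local ring with principal maximal ideal is a domain unless its dimension is zero. -/
theorem isDomain_of_maximalIdeal_eq_span {T : Type*} [CommRing T] [IsLocalRing T]
    [IsNoetherianRing T] {t : T} (ht : maximalIdeal T = Ideal.span {t})
    (hdim : ¬ ringKrullDim T ≤ 0) : IsDomain T := by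
  have hnil : ¬ IsNilpotent t := by
    intro h
    refine hdim ?_
    have : Ring.KrullDimLE 0 T := by
      rw [Ring.krullDimLE_zero_iff]
      intro I hI
      have : maximalIdeal T ≤ I := by
        rw [ht, Ideal.span_singleton_le_iff_mem]
        obtain ⟨n, hn⟩ := h
        exact hI.mem_of_pow_mem n (hn ▸ I.zero_mem)
      rw [← le_antisymm this (le_maximalIdeal hI.ne_top)]
      infer_instance
    simpa [Ring.krullDimLE_iff] using this
  -- By Krull's intersection theorem each nonzero element has a finite order with respect to `t`.
  have key : ∀ a : T, a ≠ 0 → ∃ n : ℕ, ∃ u : T, IsUnit u ∧ a = u * t ^ n := by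
    intro a ha
    have h1 : ∃ n : ℕ, a ∉ maximalIdeal T ^ n := by
      by_contra! h
      refine ha ?_
      have := Ideal.iInf_pow_eq_bot_of_isLocalRing (maximalIdeal T) Ideal.IsPrime.ne_top'
      rw [← Ideal.mem_bot, ← this]
      simpa using h
    classical
    obtain ⟨n, hn, hmin⟩ : ∃ n, a ∈ maximalIdeal T ^ n ∧ a ∉ maximalIdeal T ^ (n + 1) := by
      have h0 : Nat.find h1 ≠ 0 := by
        intro h
        have := Nat.find_spec h1
        simp [h] at this
      obtain ⟨n, hn⟩ := Nat.exists_eq_succ_of_ne_zero h0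
      refine ⟨n, ?_, ?_⟩
      · simpa using Nat.find_min h1 (m := n) (by omega)
      · simpa [hn] using Nat.find_spec h1
    rw [ht, Ideal.span_singleton_pow, Ideal.mem_span_singleton'] at hn hmin
    obtain ⟨u, rfl⟩ := hn
    refine ⟨n, u, ?_, rfl⟩
    by_contra hu
    have : u ∈ maximalIdeal T := hu
    rw [ht, Ideal.mem_span_singleton'] at this
    obtain ⟨c, rfl⟩ := this
    exact hmin ⟨c, by ring⟩
  have : NoZeroDivisors T := by
    refine ⟨fun {a b} hab => ?_⟩
    by_contra! h
    obtain ⟨n, u, hu, rfl⟩ := key a h.1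
    obtain ⟨k, w, hw, rfl⟩ := key b h.2
    refine hnil ⟨n + k, ?_⟩
    have h2 : (u * w) * t ^ (n + k) = 0 := by rw [← hab]; ring
    exact (hu.mul hw).mul_right_eq_zero.1 h2
  exact NoZeroDivisors.to_isDomain T

/-- If `m = (x, y)` in a noetherian local ring `D` of dimension at least two, then `D/(x)` is a
principal ideal domain and not a field. -/
theorem quotient_span_singleton_isDomain {D : Type*} [CommRing D] [IsLocalRing D]
    [IsNoetherianRing D] {x y : D} (hm : maximalIdeal D = Ideal.span {x, y})
    (hdim : 2 ≤ ringKrullDim D) :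
    IsDomain (D ⧸ Ideal.span {x}) ∧ IsPrincipalIdealRing (D ⧸ Ideal.span {x}) ∧
      Ideal.span {x} ≠ maximalIdeal D := by
  have hx : x ∈ maximalIdeal D := hm ▸ Ideal.subset_span (by simp)
  have hle : Ideal.span {x} ≤ maximalIdeal D := by simpa using hx
  have hne : Ideal.span {x} ≠ (⊤ : Ideal D) := fun h => by
    rw [h] at hle; exact Ideal.IsPrime.ne_top' (top_le_iff.1 hle)
  have : Nontrivial (D ⧸ Ideal.span {x}) := Ideal.Quotient.nontrivial_iff.2 hne
  have : IsLocalRing (D ⧸ Ideal.span {x}) :=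
    IsLocalRing.of_surjective' (Ideal.Quotient.mk _) Ideal.Quotient.mk_surjective
  have hd : ¬ ringKrullDim (D ⧸ Ideal.span {x}) ≤ 0 := by
    intro h
    have h1 : ringKrullDim D ≤ ringKrullDim (D ⧸ Ideal.span {x}) + 1 := by
      rw [← IsLocalRing.maximalIdeal_height_eq_ringKrullDim (R := D)]
      exact Ideal.height_le_ringKrullDim_quotient_add_one hx
    have h2 : (2 : WithBot ℕ∞) ≤ 0 + 1 := hdim.trans (h1.trans (by gcongr))
    exact absurd h2 (by decide)
  have hmax : maximalIdeal (D ⧸ Ideal.span {x}) = Ideal.span {Ideal.Quotient.mk _ y} := by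
    rw [← IsLocalRing.map_maximalIdeal_of_surjective _ Ideal.Quotient.mk_surjective, hm,
      Ideal.map_span, Set.image_pair, Ideal.Quotient.eq_zero_iff_mem.2
        (Ideal.mem_span_singleton_self x), Ideal.span_insert_zero]
  have hD := isDomain_of_maximalIdeal_eq_span hmax hd
  refine ⟨hD, ?_, ?_⟩
  · have hpr : (maximalIdeal (D ⧸ Ideal.span {x})).IsPrincipal := ⟨_, hmax⟩
    exact ((tfae_of_isNoetherianRing_of_isLocalRing_of_isDomain (D ⧸ Ideal.span {x})).out
      4 0).1 hpr
  · intro h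
    refine hd ?_
    have : (Ideal.span {x}).IsMaximal := h ▸ inferInstance
    let _ := Ideal.Quotient.field (Ideal.span {x})
    exact (ringKrullDim_eq_zero_of_field _).le

/-- A prime ideal `P` not containing an element `x` of the maximal ideal is principal if `D/(x)` is
a principal ideal ring. -/
theorem exists_eq_span_of_notMem {D : Type*} [CommRing D] [IsLocalRing D]
    [IsNoetherianRing D] {x : D} (hx : x ∈ maximalIdeal D)
    [IsPrincipalIdealRing (D ⧸ Ideal.span {x})] (P : Ideal D) [P.IsPrime] (hxP : x ∉ P) :
    ∃ g, P = Ideal.span {g} := by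
  obtain ⟨g', hg'⟩ := IsPrincipalIdealRing.principal (P.map (Ideal.Quotient.mk (Ideal.span {x})))
  obtain ⟨g, hg, rfl⟩ := (Ideal.mem_map_iff_of_surjective _ Ideal.Quotient.mk_surjective).1
    (hg' ▸ Submodule.mem_span_singleton_self g')
  refine ⟨g, le_antisymm ?_ (by simpa using hg)⟩
  refine Submodule.le_of_le_smul_of_le_jacobson_bot (I := maximalIdeal D)
    (IsNoetherian.noetherian P) (maximalIdeal_le_jacobson _) ?_
  intro a ha
  have h1 : Ideal.Quotient.mk (Ideal.span {x}) a ∈ P.map (Ideal.Quotient.mk (Ideal.span {x})) :=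
    Ideal.mem_map_of_mem _ ha
  rw [hg', Ideal.submodule_span_eq, Ideal.mem_span_singleton'] at h1
  obtain ⟨s', hs⟩ := h1
  obtain ⟨s, rfl⟩ := Ideal.Quotient.mk_surjective s'
  rw [← map_mul, eq_comm, Ideal.Quotient.eq, Ideal.mem_span_singleton'] at hs
  obtain ⟨t, ht⟩ := hs
  -- This gives `P = (g) + xP`, the input to Nakayama.
  have htP : t ∈ P := by
    refine (Ideal.IsPrime.mem_or_mem ‹P.IsPrime› (x := t) (y := x) ?_).resolve_right hxP
    rw [ht]; exact P.sub_mem ha (P.mul_mem_left s hg)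
  have : a = s * g + x • t := by rw [smul_eq_mul, mul_comm x t, ht]; ring
  rw [this]
  exact Submodule.add_mem_sup (Ideal.mul_mem_left _ _ (Ideal.mem_span_singleton_self g))
    (Submodule.smul_mem_smul hx htP)

variable {S : Type u} [CommRing S] [IsRegularLocalRing S]

theorem IsRegularLocalRing.exists_maximalIdeal_eq_span_pair (hdim : ringKrullDim S = 2) :
    ∃ x y : S, maximalIdeal S = Ideal.span {x, y} := by
  have h := IsRegularLocalRing.spanFinrank_maximalIdeal (R := S)
  rw [hdim] at h
  have h2 : (maximalIdeal S).spanFinrank = 2 := by exact_mod_cast h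
  have hfin := Submodule.FG.finite_generators (IsNoetherian.noetherian (maximalIdeal S))
  have hc := Submodule.FG.generators_ncard (IsNoetherian.noetherian (maximalIdeal S))
  rw [h2, Set.ncard_eq_two] at hc
  obtain ⟨x, y, -, hxy⟩ := hc
  exact ⟨x, y, by rw [← hxy]; exact (Submodule.span_generators _).symm⟩

/-- Let `P` be the bottom of a chain of primes of length two. The preimage `Q` of the ideal `(x)` of
`S/P` is prime and not maximal, so `Q = (x)` because `S/(x)` is a principal ideal domain. Thus `P ⊆
(x)` with `x ∉ P`, hence `P = xP`, and Nakayama gives `P = 0`. -/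
theorem IsRegularLocalRing.isDomain_of_ringKrullDim_eq_two (hdim : ringKrullDim S = 2) :
    IsDomain S := by
  obtain ⟨x, y, hm⟩ := exists_maximalIdeal_eq_span_pair hdim
  obtain ⟨h1, h2, h3⟩ := quotient_span_singleton_isDomain hm hdim.ge
  have hx : x ∈ maximalIdeal S := hm ▸ Ideal.subset_span (by simp)
  have hxp : (Ideal.span {x}).IsPrime := (Ideal.Quotient.isDomain_iff_prime _).1 h1
  obtain ⟨P, hP, hPd⟩ : ∃ P : Ideal S, P.IsPrime ∧ 2 ≤ ringKrullDim (S ⧸ P) := by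
    obtain ⟨l, hl⟩ := (Order.le_krullDim_iff (n := 2)).1 hdim.ge
    refine ⟨l.head.asIdeal, l.head.2, ?_⟩
    rw [ringKrullDim_quotient]
    refine (Order.le_krullDim_iff (n := 2)).2 ⟨⟨l.length, fun i => ⟨l i, ?_⟩, l.step⟩, hl⟩
    exact l.head_le i
  have hPm : P ≤ maximalIdeal S := le_maximalIdeal hP.ne_top
  have hloc : IsLocalRing (S ⧸ P) :=
    IsLocalRing.of_surjective' (Ideal.Quotient.mk _) Ideal.Quotient.mk_surjective
  have hmP : maximalIdeal (S ⧸ P) =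
      Ideal.span {Ideal.Quotient.mk P x, Ideal.Quotient.mk P y} := by
    rw [← IsLocalRing.map_maximalIdeal_of_surjective _ Ideal.Quotient.mk_surjective, hm,
      Ideal.map_span, Set.image_pair]
  obtain ⟨k1, k2, k3⟩ := quotient_span_singleton_isDomain hmP hPd
  have hxm : maximalIdeal S = (maximalIdeal (S ⧸ P)).comap (Ideal.Quotient.mk P) :=
    (IsLocalRing.eq_maximalIdeal (Ideal.comap_isMaximal_of_surjective _
      Ideal.Quotient.mk_surjective)).symm
  set Q := (Ideal.span {Ideal.Quotient.mk P x}).comap (Ideal.Quotient.mk P)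
  have hQ : Q.IsPrime := by
    have : (Ideal.span {Ideal.Quotient.mk P x}).IsPrime := (Ideal.Quotient.isDomain_iff_prime _).1 k1
    exact Ideal.comap_isPrime _ _
  have hQm : Q ≠ maximalIdeal S := by
    intro h
    rw [hxm] at h
    exact k3 (Ideal.comap_injective_of_surjective _ Ideal.Quotient.mk_surjective h)
  have hPQ : P ≤ Q := fun a ha => by
    simp [Q, Ideal.Quotient.eq_zero_iff_mem.2 ha]
  have hxQ : x ∈ Q := by simp [Q]
  have hQx : Q = Ideal.span {x} := by
    have hQ' : (Q.map (Ideal.Quotient.mk (Ideal.span {x}))).IsPrime :=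
      Ideal.map_isPrime_of_surjective Ideal.Quotient.mk_surjective (by simpa using hxQ)
    have hcm : (Q.map (Ideal.Quotient.mk (Ideal.span {x}))).comap
        (Ideal.Quotient.mk (Ideal.span {x})) = Q := by
      rw [Ideal.comap_map_of_surjective _ Ideal.Quotient.mk_surjective, ← RingHom.ker_eq_comap_bot,
        Ideal.mk_ker]
      simpa using hxQ
    by_cases hb : Q.map (Ideal.Quotient.mk (Ideal.span {x})) = ⊥
    · rw [← hcm, hb, ← RingHom.ker_eq_comap_bot, Ideal.mk_ker]
    · exfalso
      have := IsPrime.to_maximal_ideal hb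
      refine hQm (IsLocalRing.eq_maximalIdeal ?_)
      rw [← hcm]
      exact Ideal.comap_isMaximal_of_surjective _ Ideal.Quotient.mk_surjective
  have hxP : x ∉ P := by
    intro hxP
    have h0 : Ideal.Quotient.mk P x = 0 := Ideal.Quotient.eq_zero_iff_mem.2 hxP
    have : Q = P := by
      simp only [Q, h0, Ideal.span_singleton_zero]
      rw [← RingHom.ker_eq_comap_bot, Ideal.mk_ker]
    rw [hQx] at this
    subst this
    have h4 : ringKrullDim (S ⧸ Ideal.span {x}) ≤ 1 := by
      have : Ring.KrullDimLE 1 (S ⧸ Ideal.span {x}) := inferInstance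
      simpa [Ring.krullDimLE_iff] using this
    exact absurd (hPd.trans h4) (by decide)
  have hbot : P = ⊥ := by
    refine Submodule.eq_bot_of_le_smul_of_le_jacobson_bot (maximalIdeal S) P
      (IsNoetherian.noetherian P) ?_ (maximalIdeal_le_jacobson _)
    intro a ha
    have h5 := hPQ ha
    rw [hQx, Ideal.mem_span_singleton'] at h5
    obtain ⟨t, rfl⟩ := h5
    rw [mul_comm]
    exact Submodule.smul_mem_smul hx ((hP.mem_or_mem ha).resolve_right hxP)
  rw [hbot] at hP
  exact IsDomain.of_bot_isPrime S

theorem IsRegularLocalRing.exists_eq_span_of_isPrime (hdim : ringKrullDim S = 2)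
    (P : Ideal S) [P.IsPrime] (hP : P ≠ maximalIdeal S) : ∃ g, P = Ideal.span {g} := by
  obtain ⟨x, y, hm⟩ := exists_maximalIdeal_eq_span_pair hdim
  have hx : x ∈ maximalIdeal S := hm ▸ Ideal.subset_span (by simp)
  have hy : y ∈ maximalIdeal S := hm ▸ Ideal.subset_span (by simp)
  by_cases hxP : x ∈ P
  · by_cases hyP : y ∈ P
    · refine absurd (le_antisymm (le_maximalIdeal Ideal.IsPrime.ne_top') ?_) hP
      rw [hm, Ideal.span_le]
      rintro a (rfl | rfl) <;> assumption
    · have := (quotient_span_singleton_isDomain (x := y) (y := x)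
        (by rw [hm, Set.pair_comm]) hdim.ge).2.1
      exact exists_eq_span_of_notMem hy P hyP
  · have := (quotient_span_singleton_isDomain hm hdim.ge).2.1
    exact exists_eq_span_of_notMem hx P hxP

/-- A minimal prime over `(p)` has height at most one, so it is not maximal and is principal; its
generator divides `p` and is therefore associated to it. -/
theorem IsRegularLocalRing.prime_of_irreducible (hdim : ringKrullDim S = 2) {p : S}
    (hp : Irreducible p) : Prime p := by
  have := isDomain_of_ringKrullDim_eq_two hdim
  obtain ⟨P, hP⟩ := Ideal.nonempty_minimalPrimes (I := Ideal.span {p})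
    (by simpa [Ideal.span_singleton_eq_top] using hp.not_isUnit)
  have hPp : P.IsPrime := hP.1.1
  have hPm : P ≠ maximalIdeal S := by
    rintro rfl
    have h1 := Ideal.height_le_one_of_isPrincipal_of_mem_minimalPrimes _ _ hP
    have h2 := IsLocalRing.maximalIdeal_height_eq_ringKrullDim (R := S)
    rw [hdim] at h2
    have h3 : (maximalIdeal S).height = 2 := WithBot.coe_injective h2
    rw [h3] at h1
    exact absurd h1 (by decide)
  obtain ⟨g, rfl⟩ := exists_eq_span_of_isPrime hdim P hPm
  have hpg : p ∈ Ideal.span {g} := hP.1.2 (Ideal.mem_span_singleton_self p)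
  rw [Ideal.mem_span_singleton] at hpg
  have hg : ¬ IsUnit g := by
    simpa [Ideal.span_singleton_eq_top] using hPp.ne_top
  have hass : Associated g p := (hp.dvd_iff.1 hpg).resolve_left hg |>.symm
  rw [Ideal.span_singleton_prime] at hPp
  · exact hass.prime hPp
  · rintro rfl
    exact hp.ne_zero (zero_dvd_iff.1 hpg)

end RegularLocalRing

/-! ### Depth and the Cohen–Macaulay property in dimension at most one -/

section Depth

open IsLocalRing CMRep

theorem CMRep.depth_self_le_ringKrullDim (A : Type u) [CommRing A] [IsLocalRing A]
    [IsNoetherianRing A] : (depth A A : WithBot ℕ∞) ≤ ringKrullDim A := by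
  obtain ⟨d, hd⟩ : ∃ d : ℕ∞, ringKrullDim A = d :=
    ⟨_, (IsLocalRing.maximalIdeal_height_eq_ringKrullDim (R := A)).symm⟩
  rw [hd, WithBot.coe_le_coe]
  refine iSup_le fun ⟨rs, hrs, hreg⟩ => ?_
  have hI : Ideal.ofList rs ≤ maximalIdeal A := Ideal.span_le.2 hrs
  have hne : (⊤ : Ideal A) ≠ Ideal.ofList rs • ⊤ := by
    intro h
    rw [smul_eq_mul, Ideal.mul_top] at h
    exact Ideal.IsPrime.ne_top' (top_le_iff.1 (h ▸ hI))
  have h1 := ringKrullDim_add_length_eq_ringKrullDim_of_isRegular rs ⟨hreg, hne⟩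
  have : Nontrivial (A ⧸ Ideal.ofList rs) := Ideal.Quotient.nontrivial_iff.2
    fun h => hne (by rw [h]; simp)
  have h2 : (0 : WithBot ℕ∞) ≤ ringKrullDim (A ⧸ Ideal.ofList rs) := ringKrullDim_nonneg_of_nontrivial
  have h3 : (rs.length : WithBot ℕ∞) ≤ (d : WithBot ℕ∞) := by
    rw [← hd, ← h1]
    exact le_add_of_nonneg_left h2
  exact_mod_cast h3

theorem CMRep.one_le_depth_of_isSMulRegular {A : Type u} [CommRing A] [IsLocalRing A]
    {M : Type v} [AddCommGroup M] [Module A M] {y : A} (hy : y ∈ maximalIdeal A)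
    (hreg : IsSMulRegular M y) : 1 ≤ depth A M := by
  have := le_iSup (fun rs : {rs : List A // (∀ r ∈ rs, r ∈ maximalIdeal A) ∧
    RingTheory.Sequence.IsWeaklyRegular M rs} => (rs.1.length : ℕ∞))
    ⟨[y], by simpa using hy, (RingTheory.Sequence.isWeaklyRegular_singleton_iff M y).2 hreg⟩
  simpa [depth] using this

/-- Over a local ring of dimension at most one, the localizations of a module with a regular element
in the maximal ideal have maximal depth. -/
theorem CMRep.ringKrullDim_le_depth_localization {R : Type u} [CommRing R] [IsLocalRing R]
    (hdim : ringKrullDim R ≤ 1) {M : Type v} [AddCommGroup M] [Module R M]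
    {y : R} (hy : y ∈ maximalIdeal R) (hreg : IsSMulRegular M y) (P : Ideal R) [P.IsPrime]
    {N : Type*} [AddCommGroup N] [Module R N] [Module (Localization.AtPrime P) N]
    [IsScalarTower R (Localization.AtPrime P) N] (g : M →ₗ[R] N)
    [IsLocalizedModule P.primeCompl g] :
    ringKrullDim (Localization.AtPrime P) ≤ (depth (Localization.AtPrime P) N : WithBot ℕ∞) := by
  have hh := IsLocalization.AtPrime.ringKrullDim_eq_height P (Localization.AtPrime P)
  by_cases hP : P = maximalIdeal R
  · have h1 : ringKrullDim (Localization.AtPrime P) ≤ 1 := by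
      rw [hh]
      exact (Ideal.height_le_ringKrullDim_of_ne_top Ideal.IsPrime.ne_top').trans hdim
    refine h1.trans ?_
    have h2 : IsSMulRegular N (algebraMap R (Localization.AtPrime P) y) :=
      IsSMulRegular.of_isLocalizedModule (Localization.AtPrime P) P.primeCompl g hreg
    have h3 := one_le_depth_of_isSMulRegular (A := Localization.AtPrime P)
      ((IsLocalization.AtPrime.to_map_mem_maximal_iff _ P y).2 (hP ▸ hy)) h2
    exact_mod_cast h3
  -- A nonmaximal prime has height zero, so there the depth bound is vacuous.
  · have h0 : P.height < 1 := by
      have hlt : P < maximalIdeal R := lt_of_le_of_ne (le_maximalIdeal Ideal.IsPrime.ne_top') hP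
      have hm : (maximalIdeal R).height ≤ 1 := by
        rw [← IsLocalRing.maximalIdeal_height_eq_ringKrullDim] at hdim
        exact_mod_cast hdim
      have hfin : P.FiniteHeight := ⟨Or.inr fun h => by
        have := (Ideal.height_mono hlt.le).trans hm
        rw [h] at this
        exact absurd this (by decide)⟩
      exact (Ideal.height_strict_mono_of_isPrime hlt).trans_le hm
    rw [Order.lt_one_iff] at h0
    rw [hh, h0]
    exact_mod_cast bot_le

theorem CMRep.isMaximalCohenMacaulay_of_isSMulRegular {R : Type u} [CommRing R] [IsLocalRing R]
    (hdim : ringKrullDim R ≤ 1) {M : Type v} [AddCommGroup M] [Module R M] [Module.Finite R M]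
    {y : R} (hy : y ∈ maximalIdeal R) (hreg : IsSMulRegular M y) : IsMaximalCohenMacaulay R M :=
  ⟨inferInstance, fun P => ringKrullDim_le_depth_localization hdim hy hreg P.asIdeal
    (LocalizedModule.mkLinearMap P.asIdeal.primeCompl M)⟩

theorem CMRep.isCohenMacaulayRing_of_isSMulRegular {R : Type u} [CommRing R] [IsLocalRing R]
    [IsNoetherianRing R] (hdim : ringKrullDim R ≤ 1)
    {y : R} (hy : y ∈ maximalIdeal R) (hreg : IsSMulRegular R y) : IsCohenMacaulayRing R :=
  ⟨inferInstance, fun P => le_antisymm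
    (have := IsLocalization.isNoetherianRing P.asIdeal.primeCompl
      (Localization.AtPrime P.asIdeal) inferInstance
     depth_self_le_ringKrullDim _)
    (ringKrullDim_le_depth_localization hdim hy hreg P.asIdeal
      (Algebra.linearMap R (Localization.AtPrime P.asIdeal)))⟩

end Depth

/-! ### Prime avoidance and the dimension of a hypersurface -/

section

open IsLocalRing

variable {S : Type u} [CommRing S] [IsRegularLocalRing S]

theorem IsRegularLocalRing.not_maximalIdeal_le_span_singleton (hdim : ringKrullDim S = 2) {x : S}
    (hx : ¬ IsUnit x) : ¬ maximalIdeal S ≤ Ideal.span {x} := by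
  intro h
  have h1 : maximalIdeal S ∈ (Ideal.span {x}).minimalPrimes :=
    ⟨⟨inferInstance, by simpa using hx⟩, fun J hJ _ => h.trans hJ.2⟩
  have h2 := Ideal.height_le_one_of_isPrincipal_of_mem_minimalPrimes _ _ h1
  have h3 := IsLocalRing.maximalIdeal_height_eq_ringKrullDim (R := S)
  rw [hdim] at h3
  rw [WithBot.coe_injective h3] at h2
  exact absurd h2 (by decide)

/-- Prime avoidance for finitely many prime elements. -/
theorem IsRegularLocalRing.exists_mem_maximalIdeal_not_dvd (hdim : ringKrullDim S = 2)
    (s : Finset S) (hs : ∀ p ∈ s, Prime p) : ∃ y ∈ maximalIdeal S, ∀ p ∈ s, ¬ p ∣ y := by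
  have := isDomain_of_ringKrullDim_eq_two hdim
  by_contra! h
  have h1 : (maximalIdeal S : Set S) ⊆ ⋃ i ∈ (s : Set S), (Ideal.span {i} : Ideal S) := by
    intro y hy
    obtain ⟨p, hp, hd⟩ := h y hy
    simp only [Set.mem_iUnion]
    exact ⟨p, hp, Ideal.mem_span_singleton.2 hd⟩
  -- The two exceptional indices, allowed to be nonprime, are irrelevant: every ideal here is prime.
  rw [Ideal.subset_union_prime 0 0 fun i hi _ _ =>
    (Ideal.span_singleton_prime (hs i hi).ne_zero).2 (hs i hi)] at h1
  obtain ⟨p, hp, hd⟩ := h1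
  exact not_maximalIdeal_le_span_singleton hdim (hs p hp).not_isUnit hd

theorem IsRegularLocalRing.ringKrullDim_quotient_le_one (hdim : ringKrullDim S = 2) {f : S}
    (hf : f ≠ 0) : ringKrullDim (S ⧸ Ideal.span {f}) ≤ 1 := by
  have := isDomain_of_ringKrullDim_eq_two hdim
  have h := ringKrullDim_quotient_succ_le_of_nonZeroDivisor (mem_nonZeroDivisors_of_ne_zero hf)
  rw [hdim] at h
  induction hd : ringKrullDim (S ⧸ Ideal.span {f}) using WithBot.recBotCoe with
  | bot => exact bot_le
  | coe d =>
    rw [hd] at h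
    have h2 : d + 1 ≤ 1 + 1 := WithBot.coe_le_coe.1 h
    exact_mod_cast (ENat.add_le_add_iff_right ENat.one_ne_top).1 h2

end

/-! ### Cancelling an element prime to a product -/

section

theorem Prime.dvd_of_dvd_mul_left_of_not_dvd {S : Type u} [CommRing S] {p y : S} (hp : Prime p)
    (hy : ¬ p ∣ y) (a : S) (h : p ∣ y * a) : p ∣ a :=
  (hp.dvd_or_dvd h).resolve_left hy

theorem dvd_of_mul_dvd_mul_left {S : Type u} [CommRing S] [IsDomain S] {f g y : S} (hf0 : f ≠ 0)
    (hf : ∀ a, f ∣ y * a → f ∣ a) (hg : ∀ a, g ∣ y * a → g ∣ a) (a : S) (h : f * g ∣ y * a) :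
    f * g ∣ a := by
  obtain ⟨c, rfl⟩ := hf a (dvd_of_mul_right_dvd h)
  refine mul_dvd_mul_left f (hg c ?_)
  rw [mul_left_comm] at h
  exact (mul_dvd_mul_iff_left hf0).1 h

end

/-! ### The modules: relations, regular elements and the invariant `(p, b)` -/

section TripleExtension

variable {S : Type u} [CommRing S] (p q r b : S)

/-- The span of the columns of the matrix `[[p, b, b], [0, pq, 0], [0, 0, pr]]` over
`S/(p²qr)`. -/
def tripleExtRelations : Submodule (S ⧸ Ideal.span {p ^ 2 * q * r})
    ((S ⧸ Ideal.span {p ^ 2 * q * r}) × (S ⧸ Ideal.span {p ^ 2 * q * r}) ×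
      (S ⧸ Ideal.span {p ^ 2 * q * r})) :=
  Submodule.span _ {(Ideal.Quotient.mk _ p, 0, 0),
    (Ideal.Quotient.mk _ b, Ideal.Quotient.mk _ (p * q), 0),
    (Ideal.Quotient.mk _ b, 0, Ideal.Quotient.mk _ (p * r))}

/-- The cokernel of the matrix `[[p, b, b], [0, pq, 0], [0, 0, pr]]` over `S/(p²qr)`. -/
abbrev TripleExt : Type u :=
  ((S ⧸ Ideal.span {p ^ 2 * q * r}) × (S ⧸ Ideal.span {p ^ 2 * q * r}) ×
      (S ⧸ Ideal.span {p ^ 2 * q * r})) ⧸ tripleExtRelations p q r b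

namespace TripleExt

/-- The class of a vector with entries in `S`. -/
def of (w₁ w₂ w₃ : S) : TripleExt p q r b :=
  Submodule.Quotient.mk
    (Ideal.Quotient.mk _ w₁, Ideal.Quotient.mk _ w₂, Ideal.Quotient.mk _ w₃)

variable {p q r b}

theorem of_surjective (m : TripleExt p q r b) : ∃ w₁ w₂ w₃, of p q r b w₁ w₂ w₃ = m := by
  obtain ⟨⟨a₁, a₂, a₃⟩, rfl⟩ := Submodule.Quotient.mk_surjective _ m
  obtain ⟨w₁, rfl⟩ := Ideal.Quotient.mk_surjective a₁
  obtain ⟨w₂, rfl⟩ := Ideal.Quotient.mk_surjective a₂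
  obtain ⟨w₃, rfl⟩ := Ideal.Quotient.mk_surjective a₃
  exact ⟨w₁, w₂, w₃, rfl⟩

theorem smul_of (a w₁ w₂ w₃ : S) :
    (Ideal.Quotient.mk (Ideal.span {p ^ 2 * q * r}) a) • of p q r b w₁ w₂ w₃ =
      of p q r b (a * w₁) (a * w₂) (a * w₃) := by
  simp [of, ← Submodule.Quotient.mk_smul]

theorem of_add (w₁ w₂ w₃ z₁ z₂ z₃ : S) :
    of p q r b w₁ w₂ w₃ + of p q r b z₁ z₂ z₃ = of p q r b (w₁ + z₁) (w₂ + z₂) (w₃ + z₃) := by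
  simp [of, ← Submodule.Quotient.mk_add]

theorem of_sub (w₁ w₂ w₃ z₁ z₂ z₃ : S) :
    of p q r b w₁ w₂ w₃ - of p q r b z₁ z₂ z₃ = of p q r b (w₁ - z₁) (w₂ - z₂) (w₃ - z₃) := by
  simp [of, ← Submodule.Quotient.mk_sub]

/-- The relations can be tested over `S`, because `p²qr` times each basis vector already lies in the
`S`-span of the three columns. -/
theorem of_eq_zero_iff {w₁ w₂ w₃ : S} : of p q r b w₁ w₂ w₃ = 0 ↔
    ∃ z₁ z₂ z₃, w₁ = p * z₁ + b * (z₂ + z₃) ∧ w₂ = p * q * z₂ ∧ w₃ = p * r * z₃ := by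
  rw [of, Submodule.Quotient.mk_eq_zero, tripleExtRelations, Submodule.mem_span_triple]
  constructor
  · rintro ⟨a₁, a₂, a₃, h⟩
    obtain ⟨z₁, rfl⟩ := Ideal.Quotient.mk_surjective a₁
    obtain ⟨z₂, rfl⟩ := Ideal.Quotient.mk_surjective a₂
    obtain ⟨z₃, rfl⟩ := Ideal.Quotient.mk_surjective a₃
    simp only [Prod.smul_mk, smul_eq_mul, mul_zero, Prod.mk_add_mk, add_zero, zero_add,
      ← map_mul, ← map_add, Prod.mk.injEq, Ideal.Quotient.eq, Ideal.mem_span_singleton'] at h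
    obtain ⟨⟨y₁, h₁⟩, ⟨y₂, h₂⟩, ⟨y₃, h₃⟩⟩ := h
    -- The corrections come from `p²qr e₂ = pr·col₂ - br·col₁` and `p²qr e₃ = pq·col₃ - bq·col₁`.
    refine ⟨z₁ - p * q * r * y₁ + b * (r * y₂ + q * y₃), z₂ - p * r * y₂, z₃ - p * q * y₃,
      ?_, ?_, ?_⟩
    · linear_combination h₁
    · linear_combination h₂
    · linear_combination h₃
  · rintro ⟨z₁, z₂, z₃, rfl, rfl, rfl⟩
    refine ⟨Ideal.Quotient.mk _ z₁, Ideal.Quotient.mk _ z₂, Ideal.Quotient.mk _ z₃, ?_⟩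
    simp only [Prod.smul_mk, smul_eq_mul, mul_zero, Prod.mk_add_mk, add_zero, zero_add,
      ← map_mul, ← map_add, Prod.mk.injEq]
    refine ⟨congrArg _ (by ring), congrArg _ (by ring), congrArg _ (by ring)⟩

theorem of_mem_smul_iff {c w₁ w₂ w₃ : S} :
    (∃ m : TripleExt p q r b,
      of p q r b w₁ w₂ w₃ = (Ideal.Quotient.mk (Ideal.span {p ^ 2 * q * r}) c) • m) ↔
    ∃ u₁ u₂ u₃ z₁ z₂ z₃, w₁ = c * u₁ + p * z₁ + b * (z₂ + z₃) ∧ w₂ = c * u₂ + p * q * z₂ ∧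
      w₃ = c * u₃ + p * r * z₃ := by
  constructor
  · rintro ⟨m, hm⟩
    obtain ⟨u₁, u₂, u₃, rfl⟩ := of_surjective m
    rw [smul_of, ← sub_eq_zero, of_sub, of_eq_zero_iff] at hm
    obtain ⟨z₁, z₂, z₃, h₁, h₂, h₃⟩ := hm
    exact ⟨u₁, u₂, u₃, z₁, z₂, z₃, by linear_combination h₁, by linear_combination h₂,
      by linear_combination h₃⟩
  · rintro ⟨u₁, u₂, u₃, z₁, z₂, z₃, h₁, h₂, h₃⟩
    refine ⟨of p q r b u₁ u₂ u₃, ?_⟩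
    rw [smul_of, ← sub_eq_zero, of_sub, of_eq_zero_iff]
    exact ⟨z₁, z₂, z₃, by linear_combination h₁, by linear_combination h₂,
      by linear_combination h₃⟩

theorem isSMulRegular_quotient [IsDomain S] (hp : Prime p) (hq : Prime q) (hr : Prime r) {y : S}
    (hpy : ¬ p ∣ y) (hqy : ¬ q ∣ y) (hry : ¬ r ∣ y) :
    IsSMulRegular (S ⧸ Ideal.span {p ^ 2 * q * r})
      (Ideal.Quotient.mk (Ideal.span {p ^ 2 * q * r}) y) := by
  rw [isSMulRegular_iff_right_eq_zero_of_smul]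
  intro a ha
  obtain ⟨a, rfl⟩ := Ideal.Quotient.mk_surjective a
  rw [smul_eq_mul, ← map_mul, Ideal.Quotient.eq_zero_iff_mem, Ideal.mem_span_singleton] at ha
  rw [Ideal.Quotient.eq_zero_iff_mem, Ideal.mem_span_singleton]
  have hp' := hp.dvd_of_dvd_mul_left_of_not_dvd hpy
  have hq' := hq.dvd_of_dvd_mul_left_of_not_dvd hqy
  have hr' := hr.dvd_of_dvd_mul_left_of_not_dvd hry
  exact dvd_of_mul_dvd_mul_left (mul_ne_zero (pow_ne_zero 2 hp.ne_zero) hq.ne_zero)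
    (dvd_of_mul_dvd_mul_left (pow_ne_zero 2 hp.ne_zero)
      (by rw [sq]; exact fun a => dvd_of_mul_dvd_mul_left hp.ne_zero hp' hp' a) hq') hr' a ha

theorem isSMulRegular [IsDomain S] (hp : Prime p) (hq : Prime q) (hr : Prime r) {y : S}
    (hpy : ¬ p ∣ y) (hqy : ¬ q ∣ y) (hry : ¬ r ∣ y) :
    IsSMulRegular (TripleExt p q r b) (Ideal.Quotient.mk (Ideal.span {p ^ 2 * q * r}) y) := by
  rw [isSMulRegular_iff_right_eq_zero_of_smul]
  intro m hm
  obtain ⟨w₁, w₂, w₃, rfl⟩ := of_surjective m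
  rw [smul_of, of_eq_zero_iff] at hm
  obtain ⟨z₁, z₂, z₃, h₁, h₂, h₃⟩ := hm
  have hp' := hp.dvd_of_dvd_mul_left_of_not_dvd hpy
  have hq' := hq.dvd_of_dvd_mul_left_of_not_dvd hqy
  have hr' := hr.dvd_of_dvd_mul_left_of_not_dvd hry
  have hy : y ≠ 0 := fun h => hpy (h ▸ dvd_zero p)
  obtain ⟨v₂, rfl⟩ := dvd_of_mul_dvd_mul_left hp.ne_zero hp' hq' w₂ ⟨z₂, h₂⟩
  obtain ⟨v₃, rfl⟩ := dvd_of_mul_dvd_mul_left hp.ne_zero hp' hr' w₃ ⟨z₃, h₃⟩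
  have e₂ : z₂ = y * v₂ := by
    refine mul_left_cancel₀ (mul_ne_zero hp.ne_zero hq.ne_zero) ?_
    linear_combination -h₂
  have e₃ : z₃ = y * v₃ := by
    refine mul_left_cancel₀ (mul_ne_zero hp.ne_zero hr.ne_zero) ?_
    linear_combination -h₃
  subst e₂ e₃
  obtain ⟨v₁, h⟩ := hp' (w₁ - b * (v₂ + v₃)) ⟨z₁, by linear_combination h₁⟩
  rw [of_eq_zero_iff]
  exact ⟨v₁, v₂, v₃, by linear_combination h, rfl, rfl⟩

/-- The ideal `(p, b)` is an isomorphism invariant: it consists of the elements that kill the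
`S/p`-torsion of `M/pM`. Hence `b ∈ (p, b')` if the modules for `b` and `b'` are isomorphic. -/
theorem exists_eq_of_linearEquiv {b' : S} (hp : Prime p) (hb' : ¬ p ∣ b')
    (e : TripleExt p q r b ≃ₗ[S ⧸ Ideal.span {p ^ 2 * q * r}] TripleExt p q r b') :
    ∃ s t, b = p * s + b' * t := by
  -- In the target, `b'` kills the class of `e₁` modulo `p`.
  have h1 : (Ideal.Quotient.mk (Ideal.span {p ^ 2 * q * r}) b') • of p q r b' 1 0 0 =
      (Ideal.Quotient.mk (Ideal.span {p ^ 2 * q * r}) p) • of p q r b' 0 (-q) 0 := by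
    rw [smul_of, smul_of, ← sub_eq_zero, of_sub, of_eq_zero_iff]
    exact ⟨0, 1, 0, by ring, by ring, by ring⟩
  obtain ⟨w₁, w₂, w₃, hw⟩ := of_surjective (e.symm (of p q r b' 1 0 0))
  have h2 := congrArg e.symm h1
  rw [map_smul, map_smul, ← hw, smul_of] at h2
  obtain ⟨u₁, u₂, u₃, z₁, z₂, z₃, -, k₂, k₃⟩ := of_mem_smul_iff.1 ⟨_, h2⟩
  obtain ⟨c₂, rfl⟩ := (hp.dvd_or_dvd (a := b') (b := w₂)
    ⟨u₂ + q * z₂, by linear_combination k₂⟩).resolve_left hb'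
  obtain ⟨c₃, rfl⟩ := (hp.dvd_or_dvd (a := b') (b := w₃)
    ⟨u₃ + r * z₃, by linear_combination k₃⟩).resolve_left hb'
  -- The preimage of `e₁` is `w₁ e₁` modulo `p`, so `b` kills it modulo `p` too; applying `e` gives
  -- `b e₁ ∈ p M_{b'}`.
  obtain ⟨m, hm⟩ := (of_mem_smul_iff (p := p) (q := q) (r := r) (b := b) (c := p)
    (w₁ := b * w₁) (w₂ := b * (p * c₂)) (w₃ := b * (p * c₃))).2
    ⟨0, b * c₂ - q * w₁, b * c₃, 0, w₁, 0, by ring, by ring, by ring⟩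
  rw [← smul_of, hw, ← map_smul] at hm
  have h3 := congrArg e hm
  rw [map_smul, map_smul, LinearEquiv.apply_symm_apply, smul_of] at h3
  obtain ⟨u₁', u₂', u₃', z₁', z₂', z₃', l₁, -, -⟩ := of_mem_smul_iff.1 ⟨_, h3.trans (map_smul e _ m)⟩
  exact ⟨u₁' + z₁', z₂' + z₃', by linear_combination l₁⟩

end TripleExt

end TripleExtension

/-! ### Torsion in free modules; cyclic summands over a local ring -/

section

open IsLocalRing TensorProduct

/-- In a free module, an element killed by `c` is a multiple of `c` if this holds in the ring. -/
theorem Module.Free.exists_eq_smul_of_smul_eq_zero {A : Type*} [CommRing A] {F : Type*}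
    [AddCommGroup F] [Module A F] [Module.Free A F] {c : A}
    (hc : ∀ a, c * a = 0 → ∃ d, a = c * d) {e : F} (he : c • e = 0) : ∃ y, e = c • y := by
  let B := Module.Free.chooseBasis A F
  have h1 : ∀ i, ∃ d, B.repr e i = c * d := fun i => hc _ (by
    have := congrArg (fun z => B.repr z i) he
    simpa using this)
  choose d hd using h1
  refine ⟨∑ i ∈ (B.repr e).support, d i • B i, ?_⟩
  conv_lhs => rw [← B.linearCombination_repr e, Finsupp.linearCombination_apply, Finsupp.sum]
  rw [Finset.smul_sum]
  exact Finset.sum_congr rfl fun i _ => by rw [hd, mul_smul]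

theorem IsLocalRing.exists_span_singleton_eq_top_of_finrank_le_one {R : Type*} [CommRing R]
    [IsLocalRing R] {N : Type*} [AddCommGroup N] [Module R N] [Module.Finite R N]
    (h : Module.finrank (ResidueField R) (ResidueField R ⊗[R] N) ≤ 1) :
    ∃ y : N, Submodule.span R {y} = ⊤ := by
  obtain ⟨v, hv⟩ := finrank_le_one_iff.1 h
  obtain ⟨y, rfl⟩ := TensorProduct.mk_surjective R N (ResidueField R) residue_surjective v
  refine ⟨y, ?_⟩
  rw [← map_tensorProduct_mk_eq_top, Submodule.map_span, ← Submodule.restrictScalars_span R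
    (ResidueField R) residue_surjective, Submodule.restrictScalars_eq_top_iff,
    Set.image_singleton, eq_top_iff]
  intro w _
  exact Submodule.mem_span_singleton.2 (hv w)

/-- If a direct sum of two modules over a local ring is generated by three elements, then one of the
summands is cyclic. -/
theorem IsLocalRing.exists_span_singleton_eq_top_of_prod {R : Type*} [CommRing R]
    [IsLocalRing R] {Y Z : Type*} [AddCommGroup Y] [Module R Y] [AddCommGroup Z] [Module R Z]
    (g : (R × R × R) →ₗ[R] Y × Z) (hg : Function.Surjective g) :
    (∃ y : Y, Submodule.span R {y} = ⊤) ∨ (∃ z : Z, Submodule.span R {z} = ⊤) := by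
  have : Module.Finite R (Y × Z) := Module.Finite.of_surjective g hg
  have : Module.Finite R Y := Module.Finite.of_surjective (LinearMap.fst R Y Z)
    LinearMap.fst_surjective
  have : Module.Finite R Z := Module.Finite.of_surjective (LinearMap.snd R Y Z)
    LinearMap.snd_surjective
  have h1 : Module.finrank (ResidueField R) (ResidueField R ⊗[R] (Y × Z)) ≤
      Module.finrank (ResidueField R) (ResidueField R ⊗[R] (R × R × R)) :=
    LinearMap.finrank_le_finrank_of_surjective (f := g.baseChange (ResidueField R))
      (LinearMap.lTensor_surjective (ResidueField R) hg)
  rw [(TensorProduct.prodRight R (ResidueField R) (ResidueField R) Y Z).finrank_eq,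
    Module.finrank_prod (R := (ResidueField R)), Module.finrank_baseChange (M' := R × R × R),
    Module.finrank_prod, Module.finrank_prod, Module.finrank_self] at h1
  by_cases hY : Module.finrank (ResidueField R) (ResidueField R ⊗[R] Y) ≤ 1
  · exact Or.inl (exists_span_singleton_eq_top_of_finrank_le_one hY)
  · exact Or.inr (exists_span_singleton_eq_top_of_finrank_le_one (by omega))

end

/-! ### Indecomposability and failure of freeness at `(p)` -/

namespace TripleExt

open IsLocalRing

variable {S : Type u} [CommRing S] {p q r b : S}

/-- If `v₂` and `w₂` were units, the conditions would force first `I ⊆ (pq)`, then `pq ∈ I`, and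
then `w₂ ∈ (p, q)`. The third coordinate enters through `q ∤ r`. -/
theorem not_isUnit_of_retract [IsDomain S] [IsLocalRing S] (hp : Prime p) (hq : Prime q)
    (hqr : ¬ q ∣ r) (hpb : ¬ p ∣ b) (I : Ideal S) (v₁ v₂ w₁ w₂ w₃ : S)
    (hv₁ : p * v₁ ∈ I) (hv₂ : b * v₁ + p * q * v₂ ∈ I)
    (hw : ∀ a ∈ I, ∃ z₁ z₂ z₃, a * w₁ = p * z₁ + b * (z₂ + z₃) ∧ a * w₂ = p * q * z₂ ∧
      a * w₃ = p * r * z₃) (hv : IsUnit v₂) (hb : b ∈ maximalIdeal S) : ¬ IsUnit w₂ := by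
  intro hu
  have hI : ∀ a ∈ I, p * q ∣ a := by
    intro a ha
    obtain ⟨-, z₂, -, -, k, -⟩ := hw a ha
    exact hu.dvd_mul_right.1 ⟨z₂, k⟩
  obtain ⟨c, hc⟩ := hI _ hv₁
  obtain ⟨d, hd⟩ := hI _ hv₂
  have e₁ : v₁ = q * c := mul_left_cancel₀ hp.ne_zero (by linear_combination hc)
  subst e₁
  have e₂ : b * c = p * (d - v₂) := mul_left_cancel₀ hq.ne_zero (by linear_combination hd)
  obtain ⟨c, rfl⟩ := (hp.dvd_or_dvd ⟨_, e₂⟩).resolve_left hpb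
  have hpq : p * q ∈ I := by
    have h1 : IsUnit (b * c + v₂) := by
      by_contra h
      have h2 : v₂ ∈ maximalIdeal S := by
        have := Ideal.sub_mem _ (show b * c + v₂ ∈ maximalIdeal S from h)
          (Ideal.mul_mem_right c _ hb)
        rwa [add_sub_cancel_left] at this
      exact h2 hv
    refine (Ideal.mul_unit_mem_iff_mem I h1).1 ?_
    convert hv₂ using 1; ring
  obtain ⟨z₁, z₂, z₃, k₁, k₂, k₃⟩ := hw _ hpq
  have e₃ : w₂ = z₂ := mul_left_cancel₀ (mul_ne_zero hp.ne_zero hq.ne_zero) k₂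
  subst e₃
  have e₄ : r * z₃ = q * w₃ := mul_left_cancel₀ hp.ne_zero (by linear_combination -k₃)
  obtain ⟨z₃, rfl⟩ := (hq.dvd_or_dvd ⟨_, e₄⟩).resolve_left hqr
  obtain ⟨y, hy⟩ := (hp.dvd_or_dvd (a := b) (b := w₂ + q * z₃)
    ⟨q * w₁ - z₁, by linear_combination -k₁⟩).resolve_left hpb
  have : w₂ ∈ maximalIdeal S := by
    have h3 : w₂ = p * y - q * z₃ := by linear_combination hy
    rw [h3]
    exact Ideal.sub_mem _ (Ideal.mul_mem_right _ _ hp.not_isUnit)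
      (Ideal.mul_mem_right _ _ hq.not_isUnit)
  exact this hu

/-- A pair of a row `v` and a column `w` over `S` that presents a cyclic direct summand `S/I` of the
cokernel of `[[p, b, b], [0, pq, 0], [0, 0, pr]]` cannot exist. -/
theorem one_sub_notMem [IsDomain S] [IsLocalRing S] (hp : Prime p) (hq : Prime q) (hr : Prime r)
    (hqr : ¬ q ∣ r) (hrq : ¬ r ∣ q) (hb : b ∈ maximalIdeal S) (hpb : ¬ p ∣ b)
    (I : Ideal S) (hI : I ≠ ⊤) (v₁ v₂ v₃ w₁ w₂ w₃ : S)
    (hv₁ : p * v₁ ∈ I) (hv₂ : b * v₁ + p * q * v₂ ∈ I) (hv₃ : b * v₁ + p * r * v₃ ∈ I)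
    (hw : ∀ a ∈ I, ∃ z₁ z₂ z₃, a * w₁ = p * z₁ + b * (z₂ + z₃) ∧ a * w₂ = p * q * z₂ ∧
      a * w₃ = p * r * z₃) :
    1 - (v₁ * w₁ + v₂ * w₂ + v₃ * w₃) ∉ I := by
  intro h1
  have hsum : v₁ * w₁ + v₂ * w₂ + v₃ * w₃ ∉ maximalIdeal S := fun h => by
    have := Ideal.add_mem _ (le_maximalIdeal hI h1) h
    rw [sub_add_cancel] at this
    exact this isUnit_one
  have hcases : IsUnit (v₁ * w₁) ∨ IsUnit (v₂ * w₂) ∨ IsUnit (v₃ * w₃) := by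
    by_contra! h
    exact hsum (Ideal.add_mem _ (Ideal.add_mem _ h.1 h.2.1) h.2.2)
  rcases hcases with h | h | h
  -- Here `p, b ∈ I`, and killing `w` by both forces `w₁ ∈ (p, b)`, so `w₁` is not a unit.
  · rw [IsUnit.mul_iff] at h
    have hpI : p ∈ I := (Ideal.mul_unit_mem_iff_mem I h.1).1 hv₁
    have hbI : b ∈ I := by
      refine (Ideal.mul_unit_mem_iff_mem I h.1).1 ?_
      have := I.sub_mem hv₂ (I.mul_mem_right (q * v₂) hpI)
      convert this using 1; ring
    obtain ⟨z₁, z₂, z₃, -, k₂, k₃⟩ := hw p hpI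
    obtain ⟨y₁, y₂, y₃, l₁, l₂, l₃⟩ := hw b hbI
    have e₂ : w₂ = q * z₂ := mul_left_cancel₀ hp.ne_zero (by linear_combination k₂)
    have e₃ : w₃ = r * z₃ := mul_left_cancel₀ hp.ne_zero (by linear_combination k₃)
    subst e₂ e₃
    have f₂ : b * z₂ = p * y₂ := mul_left_cancel₀ hq.ne_zero (by linear_combination l₂)
    have f₃ : b * z₃ = p * y₃ := mul_left_cancel₀ hr.ne_zero (by linear_combination l₃)
    obtain ⟨c₂, rfl⟩ := (hp.dvd_or_dvd ⟨y₂, f₂⟩).resolve_left hpb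
    obtain ⟨c₃, rfl⟩ := (hp.dvd_or_dvd ⟨y₃, f₃⟩).resolve_left hpb
    have g₂ : y₂ = b * c₂ := mul_left_cancel₀ hp.ne_zero (by linear_combination -f₂)
    have g₃ : y₃ = b * c₃ := mul_left_cancel₀ hp.ne_zero (by linear_combination -f₃)
    subst g₂ g₃
    obtain ⟨d, hd⟩ := (hp.dvd_or_dvd (a := b) (b := w₁ - b * (c₂ + c₃))
      ⟨y₁, by linear_combination l₁⟩).resolve_left hpb
    have : w₁ ∈ maximalIdeal S := by
      have h3 : w₁ = p * d + b * (c₂ + c₃) := by linear_combination hd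
      rw [h3]
      exact Ideal.add_mem _ (Ideal.mul_mem_right _ _ hp.not_isUnit) (Ideal.mul_mem_right _ _ hb)
    exact this h.2
  · rw [IsUnit.mul_iff] at h
    exact not_isUnit_of_retract hp hq hqr hpb I v₁ v₂ w₁ w₂ w₃ hv₁ hv₂ hw h.1 hb h.2
  · rw [IsUnit.mul_iff] at h
    -- The presentation is symmetric under exchanging `(q, e₂)` with `(r, e₃)`.
    refine not_isUnit_of_retract hp hr hrq hpb I v₁ v₃ w₁ w₃ w₂ hv₁ hv₃ (fun a ha => ?_) h.1 hb h.2
    obtain ⟨z₁, z₂, z₃, k₁, k₂, k₃⟩ := hw a ha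
    exact ⟨z₁, z₃, z₂, by linear_combination k₁, k₃, k₂⟩

/-- A generator identifies the summand with `S/I`; lifting the projection to a row `v` and the
inclusion to a column `w` turns the retraction into `v·w ≡ 1` modulo `I`. -/
theorem eq_zero_of_cyclic_retract [IsDomain S] [IsLocalRing S] (hp : Prime p) (hq : Prime q)
    (hr : Prime r) (hqr : ¬ q ∣ r) (hrq : ¬ r ∣ q) (hb : b ∈ maximalIdeal S) (hpb : ¬ p ∣ b)
    {Y : Type*} [AddCommGroup Y] [Module (S ⧸ Ideal.span {p ^ 2 * q * r}) Y]
    (i : Y →ₗ[S ⧸ Ideal.span {p ^ 2 * q * r}] TripleExt p q r b)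
    (π : TripleExt p q r b →ₗ[S ⧸ Ideal.span {p ^ 2 * q * r}] Y)
    (hπ : ∀ y, π (i y) = y) (y : Y) (hy : Submodule.span (S ⧸ Ideal.span {p ^ 2 * q * r}) {y} = ⊤) :
    y = 0 := by
  by_contra hy0
  let I : Ideal S := Ideal.comap (Ideal.Quotient.mk (Ideal.span {p ^ 2 * q * r}))
    (LinearMap.ker (LinearMap.toSpanSingleton _ Y y))
  have hmem : ∀ a, a ∈ I ↔ Ideal.Quotient.mk (Ideal.span {p ^ 2 * q * r}) a • y = 0 :=
    fun a => Iff.rfl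
  have hrep : ∀ z : Y, ∃ a : S, Ideal.Quotient.mk (Ideal.span {p ^ 2 * q * r}) a • y = z := by
    intro z
    obtain ⟨a, ha⟩ := Submodule.mem_span_singleton.1 (hy ▸ Submodule.mem_top (x := z))
    obtain ⟨a, rfl⟩ := Ideal.Quotient.mk_surjective a
    exact ⟨a, ha⟩
  obtain ⟨w₁, w₂, w₃, hw⟩ := of_surjective (i y)
  obtain ⟨v₁, h₁⟩ := hrep (π (of p q r b 1 0 0))
  obtain ⟨v₂, h₂⟩ := hrep (π (of p q r b 0 1 0))
  obtain ⟨v₃, h₃⟩ := hrep (π (of p q r b 0 0 1))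
  have hπv : ∀ a₁ a₂ a₃, π (of p q r b a₁ a₂ a₃) =
      Ideal.Quotient.mk (Ideal.span {p ^ 2 * q * r}) (v₁ * a₁ + v₂ * a₂ + v₃ * a₃) • y := by
    intro a₁ a₂ a₃
    have : of p q r b a₁ a₂ a₃ =
        Ideal.Quotient.mk (Ideal.span {p ^ 2 * q * r}) a₁ • of p q r b 1 0 0 +
        Ideal.Quotient.mk (Ideal.span {p ^ 2 * q * r}) a₂ • of p q r b 0 1 0 +
        Ideal.Quotient.mk (Ideal.span {p ^ 2 * q * r}) a₃ • of p q r b 0 0 1 := by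
      simp [smul_of, of_add]
    rw [this, map_add, map_add, map_smul, map_smul, map_smul, ← h₁, ← h₂, ← h₃]
    simp only [smul_smul, ← map_mul, ← add_smul, ← map_add]
    congr 2
    ring
  have hker : ∀ a₁ a₂ a₃, of p q r b a₁ a₂ a₃ = 0 → v₁ * a₁ + v₂ * a₂ + v₃ * a₃ ∈ I := by
    intro a₁ a₂ a₃ h
    rw [hmem, ← hπv, h, map_zero]
  refine one_sub_notMem hp hq hr hqr hrq hb hpb I ?_ v₁ v₂ v₃ w₁ w₂ w₃ ?_ ?_ ?_ ?_ ?_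
  · intro h
    have : (1 : S) ∈ I := h ▸ Submodule.mem_top
    rw [hmem, map_one, one_smul] at this
    exact hy0 this
  · have := hker p 0 0 (of_eq_zero_iff.2 ⟨1, 0, 0, by ring, by ring, by ring⟩)
    convert this using 1; ring
  · have := hker b (p * q) 0 (of_eq_zero_iff.2 ⟨0, 1, 0, by ring, by ring, by ring⟩)
    convert this using 1; ring
  · have := hker b 0 (p * r) (of_eq_zero_iff.2 ⟨0, 0, 1, by ring, by ring, by ring⟩)
    convert this using 1; ring
  · intro a ha
    rw [← of_eq_zero_iff (q := q), ← smul_of, hw, ← map_smul, (hmem a).1 ha, map_zero]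
  · rw [hmem, map_sub, sub_smul, ← hπv, hw, hπ, map_one, one_smul, sub_self]

theorem indecomposable [IsDomain S] [IsLocalRing S] (hp : Prime p) (hq : Prime q)
    (hr : Prime r) (hqr : ¬ q ∣ r) (hrq : ¬ r ∣ q) (hb : b ∈ maximalIdeal S) (hpb : ¬ p ∣ b) :
    CategoryTheory.Indecomposable
      (ModuleCat.of (S ⧸ Ideal.span {p ^ 2 * q * r}) (TripleExt p q r b)) := by
  have hR : Nontrivial (S ⧸ Ideal.span {p ^ 2 * q * r}) := by
    rw [Ideal.Quotient.nontrivial_iff, Ne, Ideal.span_singleton_eq_top]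
    exact fun h => hr.not_isUnit (isUnit_of_mul_isUnit_right h)
  have : IsLocalRing (S ⧸ Ideal.span {p ^ 2 * q * r}) :=
    IsLocalRing.of_surjective' (Ideal.Quotient.mk _) Ideal.Quotient.mk_surjective
  refine ⟨?_, fun Y Z e => ?_⟩
  · intro h
    have := ModuleCat.subsingleton_of_isZero h
    have h1 : of p q r b 1 0 0 = 0 := Subsingleton.elim _ _
    obtain ⟨z₁, z₂, z₃, h1, -, -⟩ := of_eq_zero_iff.1 h1
    have h2 : (1 : S) ∈ maximalIdeal S := by
      rw [h1]
      exact Ideal.add_mem _ (Ideal.mul_mem_right _ _ hp.not_isUnit) (Ideal.mul_mem_right _ _ hb)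
    exact h2 isUnit_one
  · let e' : TripleExt p q r b ≃ₗ[S ⧸ Ideal.span {p ^ 2 * q * r}] (Y × Z) :=
      (e ≪≫ ModuleCat.biprodIsoProd Y Z).toLinearEquiv
    have key : ∀ (N : Type u) [AddCommGroup N] [Module (S ⧸ Ideal.span {p ^ 2 * q * r}) N]
        (i : N →ₗ[S ⧸ Ideal.span {p ^ 2 * q * r}] (Y × Z))
        (π : (Y × Z) →ₗ[S ⧸ Ideal.span {p ^ 2 * q * r}] N), (∀ y, π (i y) = y) →
        (∃ y : N, Submodule.span (S ⧸ Ideal.span {p ^ 2 * q * r}) {y} = ⊤) → Subsingleton N := by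
      intro N _ _ i π hπ ⟨y, hy⟩
      have h0 := eq_zero_of_cyclic_retract hp hq hr hqr hrq hb hpb
        (e'.symm.toLinearMap ∘ₗ i) (π ∘ₗ e'.toLinearMap) (by simpa using hπ) y hy
      rw [h0, Submodule.span_zero_singleton] at hy
      exact (Submodule.subsingleton_iff _).1 (subsingleton_of_bot_eq_top hy)
    rcases IsLocalRing.exists_span_singleton_eq_top_of_prod
      (e'.toLinearMap ∘ₗ (tripleExtRelations p q r b).mkQ)
      (e'.surjective.comp (Submodule.mkQ_surjective _)) with h | h
    · have := key Y (LinearMap.inl _ Y Z) (LinearMap.fst _ Y Z) (by simp) h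
      exact Or.inl (ModuleCat.isZero_of_subsingleton Y)
    · have := key Z (LinearMap.inr _ Y Z) (LinearMap.snd _ Y Z) (by simp) h
      exact Or.inr (ModuleCat.isZero_of_subsingleton Z)

/-- At the prime `(p)` the annihilator of `p` is `(p)`, so in a free module every element killed by
`p` is a multiple of `p`. The element `q e₂ - r e₃` is killed by `p`, but its second coordinate `q`
is prime to `p`. -/
theorem not_isLocallyFreeOnPuncturedSpectrum [IsDomain S] [IsLocalRing S] (hp : Prime p)
    (hpq : ¬ p ∣ q) {x : S} (hx : x ∈ maximalIdeal S) (hpx : ¬ p ∣ x) :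
    ¬ CMRep.IsLocallyFreeOnPuncturedSpectrum (S ⧸ Ideal.span {p ^ 2 * q * r})
      (TripleExt p q r b) := by
  intro h
  let σ := Ideal.Quotient.mk (Ideal.span {p ^ 2 * q * r})
  have hfp : Ideal.span {p ^ 2 * q * r} ≤ Ideal.span {p} := by
    rw [Ideal.span_singleton_le_span_singleton]
    exact ⟨p * q * r, by ring⟩
  have hpp : (Ideal.span {p}).IsPrime := (Ideal.span_singleton_prime hp.ne_zero).2 hp
  have hP : ((Ideal.span {p}).map σ).IsPrime :=
    Ideal.map_isPrime_of_surjective Ideal.Quotient.mk_surjective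
      (by simpa [σ, Ideal.mk_ker] using hfp)
  have hmem : ∀ a, σ a ∈ (Ideal.span {p}).map σ ↔ p ∣ a := by
    intro a
    rw [← Ideal.mem_span_singleton, ← Ideal.mem_comap,
      Ideal.comap_map_of_surjective _ Ideal.Quotient.mk_surjective, ← RingHom.ker_eq_comap_bot,
      Ideal.mk_ker, sup_eq_left.2 hfp]
  let P : PrimeSpectrum (S ⧸ Ideal.span {p ^ 2 * q * r}) := ⟨_, hP⟩
  have hmax : ¬ P.asIdeal.IsMaximal := by
    intro hm
    have : (P.asIdeal.comap σ).IsMaximal :=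
      Ideal.comap_isMaximal_of_surjective _ Ideal.Quotient.mk_surjective
    rw [← IsLocalRing.eq_maximalIdeal this, Ideal.mem_comap] at hx
    exact hpx ((hmem x).1 hx)
  have hfree := h P hmax
  have hann : ∀ a : Localization.AtPrime P.asIdeal, algebraMap _ _ (σ p) * a = 0 →
      ∃ d, a = algebraMap _ _ (σ p) * d := by
    intro a ha
    obtain ⟨α, s, rfl⟩ := IsLocalization.exists_mk'_eq P.asIdeal.primeCompl a
    rw [IsLocalization.mul_mk'_eq_mk'_of_mul, IsLocalization.mk'_eq_zero_iff] at ha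
    obtain ⟨⟨u, hu⟩, ha⟩ := ha
    obtain ⟨α, rfl⟩ := Ideal.Quotient.mk_surjective α
    obtain ⟨u, rfl⟩ := Ideal.Quotient.mk_surjective u
    have ha' : σ (u * (p * α)) = 0 := by simpa using ha
    rw [Ideal.Quotient.eq_zero_iff_mem, Ideal.mem_span_singleton] at ha'
    obtain ⟨c, hc⟩ := ha'
    have h1 : p ∣ u * α := ⟨q * r * c, mul_left_cancel₀ hp.ne_zero (by linear_combination hc)⟩
    obtain ⟨β, rfl⟩ := (hp.dvd_or_dvd h1).resolve_left fun h => hu ((hmem u).2 h)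
    refine ⟨IsLocalization.mk' _ (σ β) s, ?_⟩
    rw [IsLocalization.mul_mk'_eq_mk'_of_mul, ← map_mul]
  have he : (algebraMap _ (Localization.AtPrime P.asIdeal) (σ p)) •
      LocalizedModule.mkLinearMap P.asIdeal.primeCompl _ (of p q r b 0 q (-r)) = 0 := by
    rw [algebraMap_smul, ← map_smul, smul_of, of_eq_zero_iff.2, map_zero]
    exact ⟨0, 1, -1, by ring, by ring, by ring⟩
  obtain ⟨y, hy⟩ := Module.Free.exists_eq_smul_of_smul_eq_zero
    (F := LocalizedModule P.asIdeal.primeCompl (TripleExt p q r b)) hann he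
  obtain ⟨⟨m, s⟩, hs⟩ := IsLocalizedModule.surj P.asIdeal.primeCompl
    (LocalizedModule.mkLinearMap P.asIdeal.primeCompl (TripleExt p q r b)) y
  have h2 : LocalizedModule.mkLinearMap P.asIdeal.primeCompl (TripleExt p q r b)
      ((s : S ⧸ Ideal.span {p ^ 2 * q * r}) • of p q r b 0 q (-r)) =
      LocalizedModule.mkLinearMap P.asIdeal.primeCompl (TripleExt p q r b) (σ p • m) := by
    rw [map_smul, map_smul, hy, algebraMap_smul, smul_comm]
    exact congrArg _ hs
  obtain ⟨u, hu⟩ := (IsLocalizedModule.eq_iff_exists P.asIdeal.primeCompl _).1 h2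
  obtain ⟨s, hsP⟩ := s
  obtain ⟨u, huP⟩ := u
  obtain ⟨s, rfl⟩ := Ideal.Quotient.mk_surjective s
  obtain ⟨u, rfl⟩ := Ideal.Quotient.mk_surjective u
  simp only [Submonoid.smul_def] at hu
  rw [smul_comm _ (σ p) m, smul_of, smul_of] at hu
  obtain ⟨u₁, u₂, u₃, z₁, z₂, z₃, -, k, -⟩ := of_mem_smul_iff.1 ⟨_, hu⟩
  have h3 : p ∣ (u * s) * q := ⟨u₂ + q * z₂, by linear_combination k⟩
  rcases hp.dvd_or_dvd h3 with h | h
  · rcases hp.dvd_or_dvd h with h | h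
    · exact huP ((hmem u).2 h)
    · exact hsP ((hmem s).2 h)
  · exact hpq h

end TripleExt

/-! ### Infinitely many isomorphism classes -/

open IsLocalRing in
theorem TripleExt.not_nonempty_linearEquiv_of_lt {S : Type u} [CommRing S] [IsDomain S]
    [IsLocalRing S] {p q r x : S} (hp : Prime p) (hx : x ∈ maximalIdeal S) (hpx : ¬ p ∣ x)
    {n k : ℕ} (hnk : n < k) (e : TripleExt p q r (x ^ n) ≃ₗ[S ⧸ Ideal.span {p ^ 2 * q * r}]
      TripleExt p q r (x ^ k)) : False := by
  have hpow : ∀ n, ¬ p ∣ x ^ n := fun n h => hpx (hp.dvd_of_dvd_pow h)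
  obtain ⟨s, t, h⟩ := exists_eq_of_linearEquiv hp (hpow k) e
  obtain ⟨j, rfl⟩ := Nat.exists_eq_add_of_lt hnk
  -- From `xⁿ ∈ (p, xᵏ)` cancel `xⁿ` modulo `p`: then `p` divides an element congruent to `1` modulo
  -- the maximal ideal.
  have h1 : p ∣ 1 - x ^ (j + 1) * t :=
    (hp.dvd_or_dvd (a := x ^ n)
      ⟨s, by rw [add_assoc, pow_add] at h; linear_combination h⟩).resolve_left (hpow n)
  have h2 : (1 : S) ∈ maximalIdeal S := by
    have h3 : 1 - x ^ (j + 1) * t ∈ maximalIdeal S := Ideal.mem_of_dvd _ h1 hp.not_isUnit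
    have h4 : x ^ (j + 1) * t ∈ maximalIdeal S :=
      Ideal.mul_mem_right _ _ (Ideal.pow_mem_of_mem _ hx _ (Nat.succ_pos j))
    simpa using Ideal.add_mem _ h3 h4
  exact h2 isUnit_one

/-- For a two-dimensional regular local ring `S` and irreducible elements `p`, `q`, `r` that are
pairwise distinct (that is, generate pairwise distinct ideals), the Cohen-Macaulay ring
`S/(p²qr)` has infinite `CM₊`-representation type. -/
theorem theorem33 (S : Type u) [CommRing S] [IsRegularLocalRing S] (hdim : ringKrullDim S = 2)
    (p q r : S) (hp : Irreducible p) (hq : Irreducible q) (hr : Irreducible r)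
    (hpq : Ideal.span {p} ≠ Ideal.span {q}) (hpr : Ideal.span {p} ≠ Ideal.span {r})
    (hqr : Ideal.span {q} ≠ Ideal.span {r}) :
    CMRep.IsCohenMacaulayRing (S ⧸ Ideal.span {p ^ 2 * q * r}) ∧
      CMRep.HasInfiniteCMPlusRepresentationType (S ⧸ Ideal.span {p ^ 2 * q * r}) := by
  have hdom := IsRegularLocalRing.isDomain_of_ringKrullDim_eq_two hdim
  have hdvd : ∀ {a c : S}, Irreducible a → Irreducible c → Ideal.span {a} ≠ Ideal.span {c} →
      ¬ a ∣ c := fun ha hc hne h =>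
    hne (Ideal.span_singleton_eq_span_singleton.2 (ha.associated_of_dvd hc h))
  have hqr' := hdvd hq hr hqr
  have hrq' := hdvd hr hq hqr.symm
  have hpq' := hdvd hp hq hpq
  replace hp := IsRegularLocalRing.prime_of_irreducible hdim hp
  replace hq := IsRegularLocalRing.prime_of_irreducible hdim hq
  replace hr := IsRegularLocalRing.prime_of_irreducible hdim hr
  have hRdim := IsRegularLocalRing.ringKrullDim_quotient_le_one hdim
    (mul_ne_zero (mul_ne_zero (pow_ne_zero 2 hp.ne_zero) hq.ne_zero) hr.ne_zero)
  have hR : Nontrivial (S ⧸ Ideal.span {p ^ 2 * q * r}) := by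
    rw [Ideal.Quotient.nontrivial_iff, Ne, Ideal.span_singleton_eq_top]
    exact fun h => hr.not_isUnit (isUnit_of_mul_isUnit_right h)
  have hloc : IsLocalRing (S ⧸ Ideal.span {p ^ 2 * q * r}) :=
    IsLocalRing.of_surjective' (Ideal.Quotient.mk _) Ideal.Quotient.mk_surjective
  classical
  obtain ⟨x, hx, hdx⟩ := IsRegularLocalRing.exists_mem_maximalIdeal_not_dvd hdim {p, q, r}
    (by simp [hp, hq, hr])
  have hpx := hdx p (by simp)
  have hqx := hdx q (by simp)
  have hrx := hdx r (by simp)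
  have hxR : Ideal.Quotient.mk (Ideal.span {p ^ 2 * q * r}) x ∈
      IsLocalRing.maximalIdeal (S ⧸ Ideal.span {p ^ 2 * q * r}) := by
    rw [← IsLocalRing.map_maximalIdeal_of_surjective _ Ideal.Quotient.mk_surjective]
    exact Ideal.mem_map_of_mem _ hx
  refine ⟨CMRep.isCohenMacaulayRing_of_isSMulRegular hRdim hxR
    (TripleExt.isSMulRegular_quotient hp hq hr hpx hqx hrx), ?_⟩
  -- The exponent starts at one so that `b` lies in the maximal ideal, as indecomposability
  -- requires.
  refine Set.infinite_of_injective_forall_mem (f := fun n : ℕ =>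
    Quotient.mk (CategoryTheory.isIsomorphicSetoid _)
      (ModuleCat.of (S ⧸ Ideal.span {p ^ 2 * q * r}) (TripleExt p q r (x ^ (n + 1))))) ?_ ?_
  · intro n k h
    obtain ⟨e⟩ := Quotient.exact h
    rcases lt_trichotomy n k with hlt | heq | hlt
    · exact (TripleExt.not_nonempty_linearEquiv_of_lt hp hx hpx (Nat.succ_lt_succ hlt)
        e.toLinearEquiv).elim
    · exact heq
    · exact (TripleExt.not_nonempty_linearEquiv_of_lt hp hx hpx (Nat.succ_lt_succ hlt)
        e.toLinearEquiv.symm).elim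
  · intro n
    exact ⟨_, TripleExt.indecomposable hp hq hr hqr' hrq'
      (Ideal.pow_mem_of_mem _ hx _ (Nat.succ_pos n)) (fun h => hpx (hp.dvd_of_dvd_pow h)),
      ⟨CMRep.isMaximalCohenMacaulay_of_isSMulRegular hRdim hxR
        (TripleExt.isSMulRegular hp hq hr hpx hqx hrx),
        TripleExt.not_isLocallyFreeOnPuncturedSpectrum hp hpq' hx hpx⟩, rfl⟩
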